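/- Let $\gamma = (1+\sqrt5)/2$, and let $\mathcal S$ be a finite (possibly empty) set of prime numbers. Given $\bar\xi=(\xi_\infty,(\xi_p)_{p\in\mathcal S})\in\mathbb R\times\prod_{p\in\mathcal S}\mathbb Q_p$ and $\bar\lambda=(\lambda_\infty,(\lambda_p)_{p\in\mathcal S})\in\mathbb R^{|\mathcal S|+1}$, we say that $\bar\lambda$ is an exponent of approximation in degree $n$ to $\bar\xi$ if there exists a constant $c>0$ such that, for every real number $X\ge 1$, there is a non-zero point $(x_0,\dots,x_n)\in\mathbb Z^{n+1}$ with $$\max_{0\le l\le n}|x_l|\le X,\qquad \max_{0\le l\le n}|x_l-x_0\xi_\infty^l|\le cX^{-\lambda_\infty},\qquad \max_{0\le l\le n}|x_l-x_0\xi_p^l|_p\le cX^{-\lambda_p}\quad(\forall p\in\mathcal S).$$ Theorem. For any $\bar\lambda=(\lambda_\infty,(\lambda_p)_{p\in\mathcal S})$ with all components strictly positive real numbers and $$\lambda_\infty+\sum_{p\in\mathcal S}\lambda_p<\frac1\gamma,$$ there exists a non-zero point $\bar\xi=(\xi_\infty,(\xi_p)_{p\in\mathcal S})\in\mathbb R\times\prod_{p\in\mathcal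 S}\mathbb Q_p$ with $[\mathbb Q(\xi_\infty):\mathbb Q]>2$ (the degree being infinite when $\xi_\infty$ is transcendental) such that $\bar\lambda$ is an exponent of approximation in degree $2$ to $\bar\xi$. -/

import Mathlib

open scoped IntermediateField

instance factPrimeOfPrimes (p : Nat.Primes) : Fact (Nat.Prime (p : ℕ)) := ⟨p.2⟩

/-- `L_∞(x) = max_l |x_l - x_0 ξ^l|`, for an integer point `x = (x_0, …, x_n)` and a real `ξ`
(the norm on a finite product is the maximum norm). -/
noncomputable def realL {n : ℕ} (xi : ℝ) (x : Fin (n + 1) → ℤ) : ℝ :=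
  ‖fun l : Fin (n + 1) => (x l : ℝ) - (x 0 : ℝ) * xi ^ (l : ℕ)‖

/-- `L_p(x) = max_l |x_l - x_0 ξ^l|_p`, for an integer point `x = (x_0, …, x_n)` and `ξ ∈ ℚ_p`
(the norm on a finite product is the maximum norm). -/
noncomputable def padicL {n : ℕ} {p : ℕ} [Fact p.Prime] (xi : ℚ_[p])
    (x : Fin (n + 1) → ℤ) : ℝ :=
  ‖fun l : Fin (n + 1) => (x l : ℚ_[p]) - (x 0 : ℚ_[p]) * xi ^ (l : ℕ)‖

/-- `lam = (λ_∞, (λ_p)_{p ∈ S})` is an exponent of approximation in degree `n` to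
`xi = (ξ_∞, (ξ_p)_{p ∈ S})`. -/
def IsExponentOfApproximation (S : Finset Nat.Primes) (n : ℕ)
    (lam : ℝ × (S → ℝ)) (xi : ℝ × ((p : S) → ℚ_[(p : Nat.Primes)])) : Prop :=
  ∃ c : ℝ, 0 < c ∧ ∀ X : ℝ, 1 ≤ X → ∃ x : Fin (n + 1) → ℤ, x ≠ 0 ∧
    ‖fun l => (x l : ℝ)‖ ≤ X ∧
    realL xi.1 x ≤ c * X ^ (-lam.1) ∧
    ∀ p : S, padicL (xi.2 p) x ≤ c * X ^ (-lam.2 p)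

/-! ### Fibonacci words in two symmetric matrices -/

open Matrix Filter Topology

/-! A symmetric integer matrix with rows (x₀, x₁), (x₁, x₂) gives a point near a multiple of (1, ξ,
ξ²) when its determinant is small: relative to the entries in ℝ, p-adically in ℚ_p. Palindromes in
two symmetric letters have symmetric values. With letters of determinant N = ∏ p ^ a p, a word of
length n has determinant N^n, entries at most Z^n with Z = 7b², and last entry at least b^(2n).
Along palindromic prefixes of one infinite word the ratios x₁/x₀ converge, and the errors are
O((N/b²)^n) in ℝ and at most p^(-n a_p) in ℚ_p (`exists_real_limit`, `exists_padic_limit`).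

For the Fibonacci word, consecutive palindrome lengths have ratio tending to γ, so the point of
length n must serve for X up to about Z^(γn). This asks for N/b² ≤ Z^(-γλ_∞) and p^(a_p) ≥ Z^(γλ_p);
since γ(λ_∞ + ∑ λ_p) < 1, a large b leaves room for both (`exists_parameters`).

If ξ_∞ had degree at most 2, an integral linear form vanishing at (1, ξ, ξ²) would take integer
values tending to 0 on the points, hence vanish on all late ones. `not_forall_palSeq_eq_zero`
excludes this, because the factor AB or BA in the recurrence is not symmetric. -/

/-- The two-by-two symmetric matrix of determinant `N` with rows `(1, b)` and `(b, b ^ 2 + N)`. -/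
def letter (N b : ℤ) : Matrix (Fin 2) (Fin 2) ℤ := !![1, b; b, b ^ 2 + N]

/-- The alternating sequence `AB, BA, AB, …`. -/
def twist (A B : Matrix (Fin 2) (Fin 2) ℤ) (k : ℕ) : Matrix (Fin 2) (Fin 2) ℤ :=
  if Even k then A * B else B * A

/-- The palindromic prefixes of the infinite Fibonacci word, evaluated at two matrices. -/
def palSeq (A B : Matrix (Fin 2) (Fin 2) ℤ) : ℕ → Matrix (Fin 2) (Fin 2) ℤ
  | 0 => A
  | 1 => A * B * A
  | k + 2 => palSeq A B (k + 1) * twist A B k * palSeq A B k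

/-- The length of the word whose value is `palSeq A B k`. -/
def palLen (k : ℕ) : ℕ := Nat.fib (k + 4) - 2

theorem palLen_add_two (k : ℕ) : palLen k + 2 = Nat.fib (k + 4) := by
  have : Nat.fib 3 ≤ Nat.fib (k + 4) := Nat.fib_mono (by omega)
  have h3 : Nat.fib 3 = 2 := by decide
  unfold palLen
  omega

theorem palLen_rec (k : ℕ) : palLen (k + 2) = palLen (k + 1) + (1 + 1) + palLen k := by
  have h0 := palLen_add_two k
  have h1 := palLen_add_two (k + 1)
  have h2 := palLen_add_two (k + 2)
  have h : Nat.fib (k + 2 + 4) = Nat.fib (k + 4) + Nat.fib (k + 1 + 4) :=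
    Nat.fib_add_two (n := k + 4)
  omega

section

variable {A B : Matrix (Fin 2) (Fin 2) ℤ}

theorem twist_induction {P : ℕ → Matrix (Fin 2) (Fin 2) ℤ → Prop}
    (hmul : ∀ m n x y, P m x → P n y → P (m + n) (x * y)) (hA : P 1 A) (hB : P 1 B) (k : ℕ) :
    P (1 + 1) (twist A B k) := by
  unfold twist
  split_ifs
  · exact hmul _ _ _ _ hA hB
  · exact hmul _ _ _ _ hB hA

/-- A graded multiplicative property of `A` and `B` passes to all values of words. -/
theorem palSeq_induction {P : ℕ → Matrix (Fin 2) (Fin 2) ℤ → Prop}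
    (hmul : ∀ m n x y, P m x → P n y → P (m + n) (x * y)) (hA : P 1 A) (hB : P 1 B) (k : ℕ) :
    P (palLen k) (palSeq A B k) := by
  induction k using Nat.twoStepInduction with
  | zero => exact hA
  | one => exact hmul 2 1 _ _ (hmul 1 1 _ _ hA hB) hA
  | more k h0 h1 =>
    rw [palLen_rec]
    exact hmul _ _ _ _ (hmul _ _ _ _ h1 (twist_induction hmul hA hB k)) h0

theorem transpose_twist (hA : Aᵀ = A) (hB : Bᵀ = B) (k : ℕ) :
    (twist A B k)ᵀ = twist A B (k + 1) := by
  unfold twist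
  by_cases h : Even k <;> simp [h, Nat.even_add_one, hA, hB]

theorem twist_add_two (k : ℕ) : twist A B (k + 2) = twist A B k := by
  simp [twist, Nat.even_add]

/-- Unfolding the recurrence twice gives x_{k+3} = x_{k+1} W_k x_k W_{k+1} x_{k+1}, which reads the
same reversed since W_k and W_{k+1} are transposes of each other. -/
theorem transpose_palSeq (hA : Aᵀ = A) (hB : Bᵀ = B) (k : ℕ) :
    (palSeq A B k)ᵀ = palSeq A B k := by
  induction k using Nat.strong_induction_on with
  | _ k ih =>
    match k with
    | 0 => exact hA
    | 1 => simp [palSeq, hA, hB, Matrix.mul_assoc]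
    | 2 => simp [palSeq, twist, hA, hB, Matrix.mul_assoc]
    | k + 3 =>
      have h0 := ih k (by omega)
      have h1 := ih (k + 1) (by omega)
      have hk : palSeq A B (k + 3) = palSeq A B (k + 1) * twist A B k * palSeq A B k *
          twist A B (k + 1) * palSeq A B (k + 1) := rfl
      rw [hk]
      simp only [transpose_mul, h0, h1, transpose_twist hA hB, twist_add_two, Matrix.mul_assoc]

theorem nonneg_mul {x y : Matrix (Fin 2) (Fin 2) ℤ} (hx : ∀ i j, 0 ≤ x i j)
    (hy : ∀ i j, 0 ≤ y i j) (i j : Fin 2) : 0 ≤ (x * y) i j := by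
  rw [Matrix.mul_apply]
  exact Finset.sum_nonneg fun l _ => mul_nonneg (hx i l) (hy l j)

theorem palSeq_nonneg (hA : ∀ i j, 0 ≤ A i j) (hB : ∀ i j, 0 ≤ B i j) (k : ℕ) :
    ∀ i j, 0 ≤ palSeq A B k i j :=
  palSeq_induction (P := fun _ x => ∀ i j, 0 ≤ x i j)
    (fun _ _ _ _ hx hy => nonneg_mul hx hy) hA hB k

theorem exists_palSeq_eq_mul (hA : ∀ i j, 0 ≤ A i j) (hB : ∀ i j, 0 ≤ B i j) {k l : ℕ}
    (hkl : k ≤ l) :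
    ∃ R : Matrix (Fin 2) (Fin 2) ℤ, (∀ i j, 0 ≤ R i j) ∧ palSeq A B l = palSeq A B k * R := by
  induction l, hkl using Nat.le_induction with
  | base => exact ⟨1, fun i j => by fin_cases i <;> fin_cases j <;> simp, by simp⟩
  | succ l _ ih =>
    obtain ⟨R, hR, h⟩ := ih
    have step : ∃ Q : Matrix (Fin 2) (Fin 2) ℤ, (∀ i j, 0 ≤ Q i j) ∧
        palSeq A B (l + 1) = palSeq A B l * Q := by
      match l with
      | 0 => exact ⟨B * A, nonneg_mul hB hA, Matrix.mul_assoc _ _ _⟩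
      | l + 1 =>
        refine ⟨twist A B l * palSeq A B l, nonneg_mul ?_ (palSeq_nonneg hA hB l),
          Matrix.mul_assoc _ _ _⟩
        exact twist_induction (P := fun _ x => ∀ i j, 0 ≤ x i j)
          (fun _ _ _ _ hx hy => nonneg_mul hx hy) hA hB l
    obtain ⟨Q, hQ, hs⟩ := step
    exact ⟨R * Q, nonneg_mul hR hQ, by rw [hs, h, Matrix.mul_assoc]⟩

theorem det_palSeq {N : ℤ} (hA : A.det = N) (hB : B.det = N) (k : ℕ) :
    (palSeq A B k).det = N ^ palLen k :=
  palSeq_induction (P := fun n x => x.det = N ^ n)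
    (fun m n x y hx hy => by rw [det_mul, hx, hy, pow_add]) (by simp [hA]) (by simp [hB]) k

/-- A nonzero linear form does not vanish on all but finitely many values of the palindromic
prefixes. -/
theorem not_forall_palSeq_eq_zero (hA : Aᵀ = A) (hB : Bᵀ = B) (hdA : A.det ≠ 0)
    (hdB : B.det ≠ 0) (hAB : A * B ≠ B * A) {q : Fin 3 → ℤ} (hq : q ≠ 0) (k : ℕ)
    (h : ∀ l, k ≤ l → q 0 * palSeq A B l 0 0 + q 1 * palSeq A B l 0 1
      + q 2 * palSeq A B l 1 1 = 0) : False := by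
  have hdet : ∀ k, (palSeq A B k).det ≠ 0 := fun k =>
    palSeq_induction (P := fun _ x => x.det ≠ 0)
      (fun m n x y hx hy => by rw [det_mul]; exact mul_ne_zero hx hy) hdA hdB k
  have hsymm : ∀ k, palSeq A B k 1 0 = palSeq A B k 0 1 := fun k =>
    congrFun (congrFun (transpose_palSeq hA hB k) 0) 1
  have htw : ∀ k, (twist A B k)ᵀ ≠ twist A B k := by
    intro k
    rw [transpose_twist hA hB]
    unfold twist
    by_cases h : Even k <;> simp [h, Nat.even_add_one, hAB, hAB.symm]
  -- A relation among three consecutive terms has no contribution of the last one.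
  have key : ∀ (l : ℕ) (α β δ : ℤ), α • palSeq A B l + β • palSeq A B (l + 1)
      + δ • palSeq A B (l + 2) = 0 → δ = 0 := by
    intro l α β δ hrel
    by_contra hδ
    set x := palSeq A B l with hx
    set y := palSeq A B (l + 1) with hy
    have hz : palSeq A B (l + 2) = y * twist A B l * x := rfl
    rw [hz] at hrel
    -- Adjugates on both sides cancel x and y, so that a multiple of the twist becomes a combination
    -- of the symmetric matrices adj x and adj y. The twist is not symmetric.
    have h1 : y.adjugate * (α • x + β • y + δ • (y * twist A B l * x)) * x.adjugate = 0 := by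
      rw [hrel]; simp
    have h2 : y.adjugate * (α • x + β • y + δ • (y * twist A B l * x)) * x.adjugate =
        (α * x.det) • y.adjugate + (β * y.det) • x.adjugate
          + (δ * y.det * x.det) • twist A B l := by
      have e1 : y.adjugate * (y * twist A B l * x) * x.adjugate =
          (y.adjugate * y) * twist A B l * (x * x.adjugate) := by
        simp only [Matrix.mul_assoc]
      have e2 : y.adjugate * x * x.adjugate = y.adjugate * (x * x.adjugate) :=
        Matrix.mul_assoc _ _ _
      simp only [Matrix.mul_add, Matrix.add_mul, Matrix.mul_smul, Matrix.smul_mul, e1, e2,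
        adjugate_mul, mul_adjugate, Matrix.mul_one, Matrix.one_mul, smul_smul]
      congr 2
      ring
    rw [h2] at h1
    have h3 := congrArg Matrix.transpose h1
    have hxs : xᵀ = x := transpose_palSeq hA hB l
    have hys : yᵀ = y := transpose_palSeq hA hB (l + 1)
    simp only [transpose_add, transpose_smul, adjugate_transpose, hxs, hys,
      transpose_zero] at h3
    have h4 := h3.trans h1.symm
    rw [add_right_inj] at h4
    refine htw l (smul_right_injective _ ?_ h4)
    exact mul_ne_zero (mul_ne_zero hδ (hdet _)) (hdet _)
  -- Three consecutive terms are linearly dependent.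
  have dep : ∀ l, k ≤ l → ∃ α β δ : ℤ, (α ≠ 0 ∨ β ≠ 0 ∨ δ ≠ 0) ∧
      α • palSeq A B l + β • palSeq A B (l + 1) + δ • palSeq A B (l + 2) = 0 := by
    intro l hl
    let C : Matrix (Fin 3) (Fin 3) ℤ := Matrix.of fun i =>
      ![palSeq A B (l + i) 0 0, palSeq A B (l + i) 0 1, palSeq A B (l + i) 1 1]
    have hC : C *ᵥ q = 0 := by
      funext i
      have := h (l + i) (by omega)
      simp only [C, mulVec, dotProduct, Fin.sum_univ_three, of_apply, cons_val_zero,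
        cons_val_one, cons_val_two, Pi.zero_apply]
      simp
      linarith
    have hC0 : C.det = 0 := Matrix.exists_mulVec_eq_zero_iff.1 ⟨q, hq, hC⟩
    obtain ⟨v, hv, hvC⟩ := Matrix.exists_vecMul_eq_zero_iff.2 hC0
    refine ⟨v 0, v 1, v 2, ?_, ?_⟩
    · by_contra! hcon
      exact hv (funext fun i => by fin_cases i <;> simp [hcon])
    · have e0 := congrFun hvC 0
      have e1 := congrFun hvC 1
      have e2 := congrFun hvC 2
      simp [C, vecMul, dotProduct, Fin.sum_univ_three] at e0 e1 e2
      ext i j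
      fin_cases i <;> fin_cases j <;> simp only [Matrix.add_apply, Matrix.smul_apply,
        smul_eq_mul, Matrix.zero_apply, Fin.zero_eta, Fin.mk_one, hsymm] <;> assumption
  -- Starting at k + 1 leaves room to apply `key` twice: once as is, then, with δ gone, one index
  -- lower with leading coefficient 0.
  obtain ⟨α, β, δ, hne, hrel⟩ := dep (k + 1) (by omega)
  obtain rfl := key _ _ _ _ hrel
  obtain rfl := key k 0 α β (by simpa using hrel)
  have hα : α ≠ 0 := by simpa using hne
  have h0 : palSeq A B (k + 1) = 0 :=
    (smul_eq_zero.1 (by simpa only [zero_smul, add_zero] using hrel)).resolve_left hα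
  exact hdet (k + 1) (by rw [h0]; exact det_zero)

end

/-! ### Choice of the parameters -/

/-- An integer `b` and prime powers `p ^ a p` whose sizes are in the ratios prescribed by `μ`
and `ν`. -/
theorem exists_parameters (S : Finset Nat.Primes) (μ : ℝ) (ν : S → ℝ)
    (hν : ∀ p, 0 < ν p) (hsum : μ + ∑ p, ν p < 1) :
    ∃ (b : ℕ) (a : S → ℕ), 0 < b ∧ (∀ p : S, ((p : Nat.Primes) : ℕ) ∣ b) ∧
      (∀ p : S, (7 * (b : ℝ) ^ 2) ^ ν p ≤ (((p : Nat.Primes) : ℕ) : ℝ) ^ a p) ∧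
      ((∏ p : S, ((p : Nat.Primes) : ℕ) ^ a p : ℕ) : ℝ) * (7 * (b : ℝ) ^ 2) ^ μ
        ≤ (b : ℝ) ^ 2 := by
  set r : ℕ := ∏ p : S, ((p : Nat.Primes) : ℕ) with hr
  set θ : ℝ := μ + ∑ p, ν p with hθ
  have hrpos : 0 < r := Finset.prod_pos fun p _ => (p : Nat.Primes).2.pos
  -- Rounding each prime power up costs at most a factor p, altogether r, and Z exceeds b² by the
  -- factor 7. The positive exponent 1 - θ absorbs both.
  have htend : Tendsto (fun m : ℕ => (m : ℝ) ^ (1 - θ)) atTop atTop :=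
    (tendsto_rpow_atTop (by linarith)).comp tendsto_natCast_atTop_atTop
  obtain ⟨m, hm, hm1⟩ :=
    ((htend.eventually_ge_atTop (7 * r : ℝ)).and (eventually_ge_atTop 1)).exists
  have hbpos : 0 < r * m := Nat.mul_pos hrpos hm1
  set b : ℕ := r * m with hb
  have hbm : (m : ℝ) ≤ b := by
    rw [hb]; exact_mod_cast Nat.le_mul_of_pos_left m hrpos
  have hm1' : (1 : ℝ) ≤ m := by exact_mod_cast hm1
  set Z : ℝ := 7 * (b : ℝ) ^ 2 with hZ
  have hmZ : (m : ℝ) ≤ Z := by nlinarith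
  have hZ1 : 1 ≤ Z := hm1'.trans hmZ
  have hZ0 : 0 < Z := by linarith
  have hpow : ∀ p : S, ∃ n : ℕ, Z ^ ν p ≤ (((p : Nat.Primes) : ℕ) : ℝ) ^ n ∧
      (((p : Nat.Primes) : ℕ) : ℝ) ^ n ≤ (((p : Nat.Primes) : ℕ) : ℝ) * Z ^ ν p := by
    intro p
    obtain ⟨n, h1, h2⟩ := exists_nat_pow_near (Real.one_le_rpow hZ1 (hν p).le)
      (by exact_mod_cast (p : Nat.Primes).2.one_lt : (1 : ℝ) < (((p : Nat.Primes) : ℕ) : ℝ))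
    refine ⟨n + 1, h2.le, ?_⟩
    rw [pow_succ, mul_comm]
    gcongr
  choose a ha1 ha2 using hpow
  refine ⟨b, a, hbpos, fun p => (Finset.dvd_prod_of_mem _ (Finset.mem_univ p)).mul_right m,
    ha1, ?_⟩
  have hN : ((∏ p : S, ((p : Nat.Primes) : ℕ) ^ a p : ℕ) : ℝ) ≤ r * Z ^ ∑ p, ν p := by
    rw [hr]
    push_cast
    rw [Real.rpow_sum_of_pos hZ0, ← Finset.prod_mul_distrib]
    exact Finset.prod_le_prod (fun p _ => by positivity) fun p _ => ha2 p
  have h7 : (7 * r : ℝ) ≤ Z ^ (1 - θ) :=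
    hm.trans (Real.rpow_le_rpow (by positivity) hmZ (by linarith))
  have h8 : Z ^ (1 - θ) * Z ^ θ = Z := by
    rw [← Real.rpow_add hZ0]; simp
  have h9 : Z ^ (∑ p, ν p) * Z ^ μ = Z ^ θ := by
    rw [← Real.rpow_add hZ0, hθ, add_comm]
  have h10 : (r : ℝ) * Z ^ (∑ p, ν p) * Z ^ μ ≤ (b : ℝ) ^ 2 := by
    rw [mul_assoc, h9]
    have : 7 * (r : ℝ) * Z ^ θ ≤ Z :=
      (mul_le_mul_of_nonneg_right h7 (by positivity)).trans h8.le
    linarith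
  exact le_trans (by gcongr) h10

/-! ### Real and p-adic limits, integral relations -/

/-- A sequence with `dist (u k) (u l) ≤ d k → 0` for `k ≤ l` converges at the rate `d`. -/
theorem exists_norm_sub_le_of_tendsto_zero {E : Type*} [NormedAddCommGroup E] [CompleteSpace E]
    {u : ℕ → E} {d : ℕ → ℝ} (hud : ∀ k l, k ≤ l → ‖u l - u k‖ ≤ d k)
    (hd : Tendsto d atTop (𝓝 0)) : ∃ ξ, ∀ k, ‖ξ - u k‖ ≤ d k := by
  have hc : CauchySeq u := cauchySeq_of_le_tendsto_0' d
    (fun n m h => by rw [dist_comm, dist_eq_norm]; exact hud n m h) hd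
  obtain ⟨ξ, hξ⟩ := cauchySeq_tendsto_of_complete hc
  refine ⟨ξ, fun k => le_of_tendsto (hξ.sub_const (u k)).norm ?_⟩
  filter_upwards [eventually_ge_atTop k] with l hl using hud k l hl

/-- A real number whose degree over `ℚ` is at most two annihilates an integral quadratic form. -/
theorem exists_int_relation_of_rank_le_two {ξ : ℝ} (h : Module.rank ℚ ℚ⟮ξ⟯ ≤ 2) :
    ∃ q : Fin 3 → ℤ, q ≠ 0 ∧ (q 0 : ℝ) + q 1 * ξ + q 2 * ξ ^ 2 = 0 := by
  have hdep : ¬ LinearIndependent ℚ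
      (fun i : Fin 3 => (IntermediateField.AdjoinSimple.gen ℚ ξ) ^ (i : ℕ)) := by
    intro hli
    have := hli.cardinal_le_rank.trans h
    simp at this
    norm_cast at this
  have hdep2 : ¬ LinearIndependent ℤ (fun i : Fin 3 => ξ ^ (i : ℕ)) := by
    intro hli
    apply hdep
    have h2 := LinearIndependent.iff_fractionRing (R := ℤ) (K := ℚ) |>.1 hli
    apply LinearIndependent.of_comp (ℚ⟮ξ⟯.val.toLinearMap)
    have e : (ℚ⟮ξ⟯.val.toLinearMap ∘ fun i : Fin 3 =>
        (IntermediateField.AdjoinSimple.gen ℚ ξ) ^ (i : ℕ)) = fun i : Fin 3 => ξ ^ (i : ℕ) := by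
      funext i
      simp
    rw [e]
    exact h2
  rw [Fintype.not_linearIndependent_iff] at hdep2
  obtain ⟨q, hq, i, hi⟩ := hdep2
  refine ⟨q, fun h => hi (by rw [h]; rfl), ?_⟩
  simpa [Fin.sum_univ_three] using hq

/-- The integer point attached to a symmetric matrix. -/
def point (x : Matrix (Fin 2) (Fin 2) ℤ) : Fin (2 + 1) → ℤ := ![x 0 0, x 0 1, x 1 1]

theorem realL_point_le {ξ c : ℝ} {x : Matrix (Fin 2) (Fin 2) ℤ}
    (h1 : |(x 0 1 : ℝ) - x 0 0 * ξ| ≤ c) (h2 : |(x 1 1 : ℝ) - x 0 0 * ξ ^ 2| ≤ c) :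
    realL ξ (point x) ≤ c := by
  refine (pi_norm_le_iff_of_nonneg ((abs_nonneg _).trans h1)).2 fun l => ?_
  fin_cases l
  · simpa [point] using (abs_nonneg _).trans h1
  · simpa [point, Real.norm_eq_abs] using h1
  · simpa [point, Real.norm_eq_abs] using h2

theorem padicL_point_le {p : ℕ} [Fact p.Prime] {ξ : ℚ_[p]} {c : ℝ}
    {x : Matrix (Fin 2) (Fin 2) ℤ}
    (h1 : ‖(x 0 1 : ℚ_[p]) - x 0 0 * ξ‖ ≤ c) (h2 : ‖(x 1 1 : ℚ_[p]) - x 0 0 * ξ ^ 2‖ ≤ c) :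
    padicL ξ (point x) ≤ c := by
  refine (pi_norm_le_iff_of_nonneg ((norm_nonneg _).trans h1)).2 fun l => ?_
  fin_cases l
  · simpa [point] using (norm_nonneg _).trans h1
  · simpa [point] using h1
  · simpa [point] using h2

section

variable {K : Type*} [Field K] {x y R : Matrix (Fin 2) (Fin 2) ℤ}

/-- By symmetry both entries of y can be read off its first column, which is x times the first
column of R; the cross difference then contracts to det x. -/
theorem ratio_sub_ratio (hx : x 1 0 = x 0 1) (hy : y 1 0 = y 0 1) (hyx : y = x * R)
    (hx0 : (x 0 0 : K) ≠ 0) (hy0 : (y 0 0 : K) ≠ 0) :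
    (y 0 1 : K) / y 0 0 - (x 0 1 : K) / x 0 0 =
      ((x.det : ℤ) : K) * (R 1 0 : K) / ((x 0 0 : K) * y 0 0) := by
  rw [div_sub_div _ _ hy0 hx0, mul_comm (x 0 0 : K)]
  congr 1
  have e0 : y 0 0 = x 0 0 * R 0 0 + x 0 1 * R 1 0 := by
    rw [hyx, Matrix.mul_apply, Fin.sum_univ_two]
  have e1 : y 0 1 = x 0 1 * R 0 0 + x 1 1 * R 1 0 := by
    rw [← hy, hyx, Matrix.mul_apply, Fin.sum_univ_two, hx]
  rw [e0, e1, det_fin_two, hx]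
  push_cast
  ring

/-- Reduces the error in the quadratic coordinate to the linear one, through x₀x₂ = det x + x₁². -/
theorem sub_mul_sq_eq (hx : x 1 0 = x 0 1) (hx0 : (x 0 0 : K) ≠ 0) (ξ : K) :
    (x 1 1 : K) - x 0 0 * ξ ^ 2 =
      (((x.det : ℤ) : K) + x 0 1 * ((x 0 1 : K) - x 0 0 * ξ)) / x 0 0
        + ξ * ((x 0 1 : K) - x 0 0 * ξ) := by
  rw [det_fin_two, hx]
  field_simp
  push_cast
  ring

end

/-- Nonnegativity of R gives R₁₀x₁ ≤ y₀ for a later term y, hence ratios converging at rate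
det/(x₀x₁). The bounds by T make the entries comparable, so that all errors are measured by det/x₂.
-/
theorem exists_real_limit {x : ℕ → Matrix (Fin 2) (Fin 2) ℤ} {T : ℝ}
    (hsymm : ∀ k, x k 1 0 = x k 0 1)
    (hpre : ∀ k l, k ≤ l → ∃ R : Matrix (Fin 2) (Fin 2) ℤ, (∀ i j, 0 ≤ R i j) ∧ x l = x k * R)
    (hT : 1 ≤ T) (h01 : ∀ k, (x k 0 1 : ℝ) ≤ T * x k 0 0)
    (h11 : ∀ k, (x k 1 1 : ℝ) ≤ T * x k 0 1)
    (hpos : ∀ k, 0 < x k 1 1) (hdet : ∀ k, 0 ≤ (x k).det)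
    (htend : Tendsto (fun k => ((x k).det : ℝ) / x k 1 1) atTop (𝓝 0)) :
    ∃ ξ C : ℝ, 0 < C ∧ ∀ k, realL ξ (point (x k)) ≤ C * (((x k).det : ℝ) / x k 1 1) := by
  have hT0 : 0 < T := by linarith
  have p2 : ∀ k, (0 : ℝ) < x k 1 1 := fun k => by exact_mod_cast hpos k
  have p1 : ∀ k, (0 : ℝ) < x k 0 1 := fun k =>
    pos_of_mul_pos_right ((p2 k).trans_le (h11 k)) hT0.le
  have p0 : ∀ k, (0 : ℝ) < x k 0 0 := fun k =>
    pos_of_mul_pos_right ((p1 k).trans_le (h01 k)) hT0.le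
  have pd : ∀ k, (0 : ℝ) ≤ ((x k).det : ℤ) := fun k => by exact_mod_cast hdet k
  have hb1 : ∀ k, ((x k).det : ℝ) / x k 0 1 ≤ T * (((x k).det : ℝ) / x k 1 1) := by
    intro k
    rw [← mul_div_assoc, div_le_div_iff₀ (p1 k) (p2 k)]
    calc ((x k).det : ℝ) * x k 1 1 ≤ (x k).det * (T * x k 0 1) :=
          mul_le_mul_of_nonneg_left (h11 k) (pd k)
      _ = T * (x k).det * x k 0 1 := by ring
  have hb0 : ∀ k, ((x k).det : ℝ) / x k 0 0 ≤ T ^ 2 * (((x k).det : ℝ) / x k 1 1) := by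
    intro k
    have : ((x k).det : ℝ) / x k 0 0 ≤ T * (((x k).det : ℝ) / x k 0 1) := by
      rw [← mul_div_assoc, div_le_div_iff₀ (p0 k) (p1 k)]
      calc ((x k).det : ℝ) * x k 0 1 ≤ (x k).det * (T * x k 0 0) :=
            mul_le_mul_of_nonneg_left (h01 k) (pd k)
        _ = T * (x k).det * x k 0 0 := by ring
    calc _ ≤ _ := this
      _ ≤ T * (T * (((x k).det : ℝ) / x k 1 1)) := mul_le_mul_of_nonneg_left (hb1 k) hT0.le
      _ = _ := by ring
  obtain ⟨ξ, hξ⟩ := exists_norm_sub_le_of_tendsto_zero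
    (u := fun k => (x k 0 1 : ℝ) / x k 0 0)
    (d := fun k => ((x k).det : ℝ) / (x k 0 0 * x k 0 1)) (by
      intro k l hkl
      obtain ⟨R, hR, hl⟩ := hpre k l hkl
      have hR0 : (0 : ℝ) ≤ R 0 0 := by exact_mod_cast hR 0 0
      have hR1 : (0 : ℝ) ≤ R 1 0 := by exact_mod_cast hR 1 0
      rw [ratio_sub_ratio (hsymm k) (hsymm l) hl (p0 k).ne' (p0 l).ne', Real.norm_eq_abs,
        abs_of_nonneg (div_nonneg (mul_nonneg (pd k) hR1) (mul_pos (p0 k) (p0 l)).le),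
        div_le_div_iff₀ (mul_pos (p0 k) (p0 l)) (mul_pos (p0 k) (p1 k))]
      have e : (x l 0 0 : ℝ) = x k 0 0 * R 0 0 + x k 0 1 * R 1 0 := by
        rw [hl, Matrix.mul_apply, Fin.sum_univ_two]; push_cast; ring
      have hle : (R 1 0 : ℝ) * x k 0 1 ≤ x l 0 0 := by
        rw [e]; nlinarith [mul_nonneg (p0 k).le hR0]
      calc ((x k).det : ℝ) * R 1 0 * (x k 0 0 * x k 0 1)
          = ((x k).det : ℝ) * x k 0 0 * (R 1 0 * x k 0 1) := by ring
        _ ≤ ((x k).det : ℝ) * x k 0 0 * x l 0 0 :=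
            mul_le_mul_of_nonneg_left hle (mul_nonneg (pd k) (p0 k).le)
        _ = _ := by ring) (by
      have ht := htend.const_mul T
      rw [mul_zero] at ht
      refine squeeze_zero (fun k => div_nonneg (pd k) (mul_pos (p0 k) (p1 k)).le) (fun k => ?_) ht
      refine le_trans ?_ (hb1 k)
      have h1 : (1 : ℝ) ≤ x k 0 0 := by
        have := p0 k
        exact_mod_cast (Int.cast_pos.1 this : 0 < x k 0 0)
      exact div_le_div_of_nonneg_left (pd k) (p1 k) (le_mul_of_one_le_left (p1 k).le h1))
  refine ⟨ξ, 2 * T ^ 2 + T + |ξ| * T, by positivity, fun k => ?_⟩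
  set q : ℝ := ((x k).det : ℝ) / x k 1 1 with hq
  have hq0 : 0 ≤ q := div_nonneg (pd k) (p2 k).le
  have he : |(x k 0 1 : ℝ) - x k 0 0 * ξ| ≤ ((x k).det : ℝ) / x k 0 1 := by
    have e : (x k 0 1 : ℝ) - x k 0 0 * ξ = -(x k 0 0 * (ξ - (x k 0 1 : ℝ) / x k 0 0)) := by
      have := (p0 k).ne'
      field_simp
      ring
    rw [e, abs_neg, abs_mul, abs_of_pos (p0 k)]
    calc _ ≤ (x k 0 0 : ℝ) * (((x k).det : ℝ) / (x k 0 0 * x k 0 1)) :=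
          mul_le_mul_of_nonneg_left (hξ k) (p0 k).le
      _ = _ := by
        have := (p0 k).ne'
        have := (p1 k).ne'
        field_simp
  refine realL_point_le ((he.trans (hb1 k)).trans ?_) ?_
  · apply mul_le_mul_of_nonneg_right _ hq0
    have : 0 ≤ |ξ| * T := by positivity
    nlinarith
  · rw [sub_mul_sq_eq (hsymm k) (p0 k).ne' ξ]
    have hA : |((((x k).det : ℤ) : ℝ) + x k 0 1 * ((x k 0 1 : ℝ) - x k 0 0 * ξ)) / x k 0 0|
        ≤ 2 * (((x k).det : ℝ) / x k 0 0) := by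
      rw [abs_div, abs_of_pos (p0 k), ← mul_div_assoc]
      apply div_le_div_of_nonneg_right _ (p0 k).le
      refine (abs_add_le _ _).trans ?_
      rw [abs_of_nonneg (pd k), abs_mul, abs_of_pos (p1 k)]
      have := mul_le_mul_of_nonneg_left he (p1 k).le
      rw [mul_div_cancel₀ _ (p1 k).ne'] at this
      linarith
    have hB : |ξ * ((x k 0 1 : ℝ) - x k 0 0 * ξ)| ≤ |ξ| * (T * q) := by
      rw [abs_mul]
      exact mul_le_mul_of_nonneg_left (he.trans (hb1 k)) (abs_nonneg _)
    have hC := hb0 k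
    have hTq : 0 ≤ T * q := by positivity
    calc _ ≤ _ := abs_add_le _ _
      _ ≤ 2 * (T ^ 2 * q) + |ξ| * (T * q) := by linarith
      _ ≤ _ := by linarith

/-- Since x₀ is a p-adic unit, no division loses anything, and the ultrametric inequality keeps the
constant equal to 1. -/
theorem exists_padic_limit {p : ℕ} [Fact p.Prime] {x : ℕ → Matrix (Fin 2) (Fin 2) ℤ}
    (hsymm : ∀ k, x k 1 0 = x k 0 1)
    (hpre : ∀ k l, k ≤ l → ∃ R : Matrix (Fin 2) (Fin 2) ℤ, x l = x k * R)
    (hunit : ∀ k, ‖(x k 0 0 : ℚ_[p])‖ = 1)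
    (htend : Tendsto (fun k => ‖(((x k).det : ℤ) : ℚ_[p])‖) atTop (𝓝 0)) :
    ∃ ξ : ℚ_[p], ∀ k, padicL ξ (point (x k)) ≤ ‖(((x k).det : ℤ) : ℚ_[p])‖ := by
  have h0 : ∀ k, (x k 0 0 : ℚ_[p]) ≠ 0 := fun k => by
    rw [← norm_ne_zero_iff, hunit]; exact one_ne_zero
  obtain ⟨ξ, hξ⟩ := exists_norm_sub_le_of_tendsto_zero
    (u := fun k => (x k 0 1 : ℚ_[p]) / x k 0 0) (by
      intro k l hkl
      obtain ⟨R, hl⟩ := hpre k l hkl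
      rw [ratio_sub_ratio (hsymm k) (hsymm l) hl (h0 k) (h0 l), norm_div, norm_mul, norm_mul,
        hunit, hunit, mul_one, div_one]
      exact mul_le_of_le_one_right (norm_nonneg _) (Padic.norm_int_le_one _)) htend
  have hξ1 : ‖ξ‖ ≤ 1 := by
    have e : ξ = (ξ - (x 0 0 1 : ℚ_[p]) / x 0 0 0) + (x 0 0 1 : ℚ_[p]) / x 0 0 0 := by ring
    rw [e]
    refine (Padic.nonarchimedean _ _).trans (max_le ?_ ?_)
    · exact (hξ 0).trans (Padic.norm_int_le_one _)
    · rw [norm_div, hunit, div_one]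
      exact Padic.norm_int_le_one _
  refine ⟨ξ, fun k => ?_⟩
  have he : ‖(x k 0 1 : ℚ_[p]) - x k 0 0 * ξ‖ ≤ ‖(((x k).det : ℤ) : ℚ_[p])‖ := by
    have e : (x k 0 1 : ℚ_[p]) - x k 0 0 * ξ
        = -(x k 0 0 * (ξ - (x k 0 1 : ℚ_[p]) / x k 0 0)) := by
      have := h0 k
      field_simp
      ring
    rw [e, norm_neg, norm_mul, hunit, one_mul]
    exact hξ k
  refine padicL_point_le he ?_
  rw [sub_mul_sq_eq (hsymm k) (h0 k) ξ]
  refine (Padic.nonarchimedean _ _).trans (max_le ?_ ?_)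
  · rw [norm_div, hunit, div_one]
    refine (Padic.nonarchimedean _ _).trans (max_le le_rfl ?_)
    rw [norm_mul]
    exact (mul_le_of_le_one_left (norm_nonneg _) (Padic.norm_int_le_one _)).trans he
  · rw [norm_mul]
    exact (mul_le_of_le_one_left (norm_nonneg _) hξ1).trans he

/-! ### The letters of determinant N -/

section

variable {N b : ℤ}

theorem det_letter (N b : ℤ) : (letter N b).det = N := by
  simp [letter, det_fin_two]; ring

theorem transpose_letter (N b : ℤ) : (letter N b)ᵀ = letter N b := by
  ext i j
  fin_cases i <;> fin_cases j <;> rfl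

theorem letter_nonneg (hN : 0 ≤ N) (hb : 0 ≤ b) (i j : Fin 2) : 0 ≤ letter N b i j := by
  fin_cases i <;> fin_cases j <;> simp [letter] <;> positivity

theorem letter_mul_letter_ne (hb : 0 < b) (hN : N ≤ b ^ 2) :
    letter N b * letter N (2 * b) ≠ letter N (2 * b) * letter N b := by
  intro h
  have h01 := congrFun (congrFun h 0) 1
  simp [letter] at h01
  have : b * (1 + 2 * b ^ 2 - N) = 0 := by linarith
  rcases mul_eq_zero.1 this with h | h <;> nlinarith

/-- Nonnegative entries, row sums at most `Z`, and last entry at least `t`. -/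
def GrowthBound (t Z : ℤ) (x : Matrix (Fin 2) (Fin 2) ℤ) : Prop :=
  (∀ i j, 0 ≤ x i j) ∧ (∀ i, x i 0 + x i 1 ≤ Z) ∧ t ≤ x 1 1

theorem GrowthBound.mul {t Z t' Z' : ℤ} {x y : Matrix (Fin 2) (Fin 2) ℤ} (ht' : 0 ≤ t')
    (hx : GrowthBound t Z x) (hy : GrowthBound t' Z' y) :
    GrowthBound (t * t') (Z * Z') (x * y) := by
  obtain ⟨hx0, hxZ, hxt⟩ := hx
  obtain ⟨hy0, hyZ, hyt⟩ := hy
  have hZ' : 0 ≤ Z' := (add_nonneg (hy0 0 0) (hy0 0 1)).trans (hyZ 0)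
  refine ⟨nonneg_mul hx0 hy0, fun i => ?_, ?_⟩
  · simp only [Matrix.mul_apply, Fin.sum_univ_two]
    calc _ = x i 0 * (y 0 0 + y 0 1) + x i 1 * (y 1 0 + y 1 1) := by ring
      _ ≤ x i 0 * Z' + x i 1 * Z' :=
          add_le_add (mul_le_mul_of_nonneg_left (hyZ 0) (hx0 i 0))
            (mul_le_mul_of_nonneg_left (hyZ 1) (hx0 i 1))
      _ = (x i 0 + x i 1) * Z' := by ring
      _ ≤ Z * Z' := mul_le_mul_of_nonneg_right (hxZ i) hZ'
  · simp only [Matrix.mul_apply, Fin.sum_univ_two]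
    have h1 : t * t' ≤ x 1 1 * y 1 1 := mul_le_mul hxt hyt ht' (hx0 1 1)
    have h2 := mul_nonneg (hx0 1 0) (hy0 0 1)
    linarith

/-- The constant 7 comes from the lower row of the second letter: 2b + 4b² + N ≤ 7b². -/
theorem growthBound_palSeq_letter (hb : 0 < b) (hN : 0 ≤ N) (hNb : N ≤ b ^ 2) (k : ℕ) :
    GrowthBound ((b ^ 2) ^ palLen k) ((7 * b ^ 2) ^ palLen k)
      (palSeq (letter N b) (letter N (2 * b)) k) := by
  have hb1 : b ≤ b ^ 2 := by nlinarith
  refine palSeq_induction (P := fun n x => GrowthBound ((b ^ 2) ^ n) ((7 * b ^ 2) ^ n) x)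
    (fun m n x y hx hy => ?_) ?_ ?_ k
  · simp only [pow_add _ m n]
    exact hx.mul (by positivity) hy
  · refine ⟨letter_nonneg hN hb.le, fun i => ?_, ?_⟩
    · fin_cases i <;> simp [letter] <;> linarith
    · simp [letter]; linarith
  · refine ⟨letter_nonneg hN (by linarith), fun i => ?_, ?_⟩
    · fin_cases i <;> simp [letter] <;> linarith
    · simp [letter]; linarith

/-- As p divides b, both letters are diagonal modulo p with upper left entry 1. -/
theorem norm_palSeq_letter_zero_zero {p : ℕ} [Fact p.Prime] (hp : (p : ℤ) ∣ b) (k : ℕ) :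
    ‖(palSeq (letter N b) (letter N (2 * b)) k 0 0 : ℚ_[p])‖ = 1 := by
  have h := palSeq_induction (A := letter N b) (B := letter N (2 * b))
    (P := fun _ x => (p : ℤ) ∣ x 0 0 - 1 ∧ (p : ℤ) ∣ x 0 1)
    (fun m n x y hx hy => by
      simp only [Matrix.mul_apply, Fin.sum_univ_two]
      constructor
      · have e : x 0 0 * y 0 0 + x 0 1 * y 1 0 - 1
            = (x 0 0 - 1) * y 0 0 + (y 0 0 - 1) + x 0 1 * y 1 0 := by ring
        rw [e]
        exact dvd_add (dvd_add (hx.1.mul_right _) hy.1) (hx.2.mul_right _)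
      · exact dvd_add (hy.2.mul_left _) (hx.2.mul_right _))
    (by simpa [letter] using hp) (by simpa [letter] using hp.mul_left 2) k
  refine le_antisymm (Padic.norm_int_le_one _) (not_lt.1 fun hlt => ?_)
  rw [Padic.norm_intCast_lt_one_iff] at hlt
  have h1 : (p : ℤ) ∣ 1 := by
    have := dvd_sub hlt h.1
    simpa using this
  exact (Nat.Prime.one_lt Fact.out).ne' (Nat.dvd_one.1 (by exact_mod_cast h1))

/-- Every prefix starts with the first letter, whose rows satisfy this inequality; right
multiplication by a nonnegative matrix preserves it. -/
theorem palSeq_letter_row_le (hb : 0 < b) (hN : 0 ≤ N) (k : ℕ) (j : Fin 2) :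
    palSeq (letter N b) (letter N (2 * b)) k 1 j
      ≤ (b ^ 2 + N) * palSeq (letter N b) (letter N (2 * b)) k 0 j := by
  obtain ⟨R, hR, h⟩ := exists_palSeq_eq_mul (letter_nonneg hN hb.le)
    (letter_nonneg hN (by linarith : 0 ≤ 2 * b)) (Nat.zero_le k)
  rw [h]
  simp only [Matrix.mul_apply, Fin.sum_univ_two, palSeq, letter]
  simp
  have h0 := mul_nonneg (by nlinarith : 0 ≤ b ^ 2 + N - b) (hR 0 j)
  have h1 := mul_nonneg (by nlinarith : 0 ≤ (b ^ 2 + N) * (b - 1)) (hR 1 j)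
  nlinarith

end

/-! ### Fibonacci exponents, the degree criterion, norm bounds -/

theorem lt_palLen (k : ℕ) : k < palLen k := by
  have := Nat.le_fib_add_one (k + 4)
  have := palLen_add_two k
  omega

/-- F(k+5) = γF(k+4) + γ'^(k+4) with |γ'| < 1 the conjugate of γ, and F(k+4) exceeds the length by
2; 2γ + 1 ≤ 5. -/
theorem fib_add_five_le (k : ℕ) : (Nat.fib (k + 5) : ℝ) ≤ Real.goldenRatio * palLen k + 5 := by
  have h1 := Real.fib_succ_sub_goldenRatio_mul_fib (k + 4)
  have h2 : Real.goldenConj ^ (k + 4) ≤ 1 := by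
    refine (le_abs_self _).trans ?_
    rw [abs_pow]
    exact pow_le_one₀ (abs_nonneg _)
      (abs_le.2 ⟨Real.neg_one_lt_goldenConj.le, Real.goldenConj_neg.le.trans zero_le_one⟩)
  have h3 : (palLen k : ℝ) + 2 = Nat.fib (k + 4) := by exact_mod_cast palLen_add_two k
  rw [← h3] at h1
  have h4 := Real.goldenRatio_lt_two
  have h5 : ((Nat.fib (k + 5) : ℕ) : ℝ) = Nat.fib (k + 4 + 1) := rfl
  rw [h5]
  linarith

/-- Turns decay in the word length into decay in X up to the next threshold; Z^(5l) pays for the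
additive 5 of `fib_add_five_le`. -/
theorem rpow_goldenRatio_pow_palLen_le {Z X l : ℝ} {k : ℕ} (hZ : 1 ≤ Z) (hX : 0 < X)
    (hl : 0 ≤ l) (hXZ : X ≤ Z ^ Nat.fib (k + 5)) :
    (Z ^ (-(Real.goldenRatio * l))) ^ palLen k ≤ Z ^ (5 * l) * X ^ (-l) := by
  have hZ0 : 0 < Z := by linarith
  have h1 : Z ^ (-(l * Nat.fib (k + 5))) ≤ X ^ (-l) := by
    have := Real.rpow_le_rpow_of_nonpos hX hXZ (neg_nonpos.2 hl)
    rwa [← Real.rpow_natCast, ← Real.rpow_mul hZ0.le, mul_comm, neg_mul] at this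
  refine le_trans ?_ (mul_le_mul_of_nonneg_left h1 (by positivity))
  rw [← Real.rpow_natCast, ← Real.rpow_mul hZ0.le, ← Real.rpow_add hZ0]
  apply Real.rpow_le_rpow_of_exponent_le hZ
  have := mul_le_mul_of_nonneg_left (fib_add_five_le k) hl
  linarith

/-- A real number approximated by integer points tending to the curve `(1, ξ, ξ ^ 2)`, not
eventually contained in a plane, has degree greater than two. -/
theorem two_lt_rank_of_tendsto {ξ : ℝ} {x : ℕ → Fin (2 + 1) → ℤ}
    (htend : Tendsto (fun k => realL ξ (x k)) atTop (𝓝 0))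
    (hplane : ∀ q : Fin 3 → ℤ, q ≠ 0 → ∀ k, ∃ l, k ≤ l ∧
      q 0 * x l 0 + q 1 * x l 1 + q 2 * x l 2 ≠ 0) :
    2 < Module.rank ℚ ℚ⟮ξ⟯ := by
  by_contra hcon
  obtain ⟨q, hq, hrel⟩ := exists_int_relation_of_rank_le_two (not_lt.1 hcon)
  have ht := htend.const_mul (|(q 1 : ℝ)| + |(q 2 : ℝ)|)
  rw [mul_zero] at ht
  obtain ⟨k, hk⟩ := eventually_atTop.1 (ht.eventually_lt_const one_pos)
  obtain ⟨l, hl, hne⟩ := hplane q hq k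
  have h1 : |(x l 1 : ℝ) - x l 0 * ξ| ≤ realL ξ (x l) := by
    simpa [realL, Real.norm_eq_abs] using norm_le_pi_norm
      (fun i : Fin (2 + 1) => (x l i : ℝ) - (x l 0 : ℝ) * ξ ^ (i : ℕ)) 1
  have h2 : |(x l 2 : ℝ) - x l 0 * ξ ^ 2| ≤ realL ξ (x l) := by
    simpa [realL, Real.norm_eq_abs] using norm_le_pi_norm
      (fun i : Fin (2 + 1) => (x l i : ℝ) - (x l 0 : ℝ) * ξ ^ (i : ℕ)) 2
  have e : ((q 0 * x l 0 + q 1 * x l 1 + q 2 * x l 2 : ℤ) : ℝ) =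
      q 1 * ((x l 1 : ℝ) - x l 0 * ξ) + q 2 * ((x l 2 : ℝ) - x l 0 * ξ ^ 2) := by
    push_cast
    linear_combination (x l 0 : ℝ) * hrel
  have h3 : |((q 0 * x l 0 + q 1 * x l 1 + q 2 * x l 2 : ℤ) : ℝ)| < 1 := by
    rw [e]
    refine (abs_add_le _ _).trans_lt (lt_of_le_of_lt ?_ (hk l hl))
    rw [abs_mul, abs_mul, add_mul]
    gcongr
  rw [← Int.cast_abs] at h3
  have h4 : |q 0 * x l 0 + q 1 * x l 1 + q 2 * x l 2| < 1 := by exact_mod_cast h3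
  exact hne (Int.abs_lt_one_iff.1 h4)

theorem norm_intCast_fin_three_le {x : Matrix (Fin 2) (Fin 2) ℤ} {Z : ℤ}
    (h0 : ∀ i j, 0 ≤ x i j) (hZ : ∀ i, x i 0 + x i 1 ≤ Z) :
    ‖fun l => (point x l : ℝ)‖ ≤ Z := by
  have hle : ∀ l, 0 ≤ point x l ∧ point x l ≤ Z := by
    intro l
    have := hZ 0
    have := hZ 1
    have := h0 0 0
    have := h0 0 1
    have := h0 1 0
    have := h0 1 1
    fin_cases l <;> simp [point] <;> omega
  have hZ0 : 0 ≤ Z := (hle 0).1.trans (hle 0).2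
  refine (pi_norm_le_iff_of_nonneg (by exact_mod_cast hZ0)).2 fun l => ?_
  rw [Real.norm_eq_abs, abs_of_nonneg (by exact_mod_cast (hle l).1)]
  exact_mod_cast (hle l).2

theorem exists_pow_fib_le_lt {Z X : ℝ} (hZ : 1 < Z) (hX : Z ^ Nat.fib 4 ≤ X) :
    ∃ k, Z ^ Nat.fib (k + 4) ≤ X ∧ X < Z ^ Nat.fib (k + 5) := by
  have hex : ∃ k, X < Z ^ Nat.fib (k + 4) := by
    obtain ⟨n, hn⟩ := pow_unbounded_of_one_lt X hZ
    refine ⟨n, hn.trans_le (pow_le_pow_right₀ hZ.le ?_)⟩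
    have := lt_palLen n
    have := palLen_add_two n
    omega
  classical
  obtain ⟨k, hk⟩ : ∃ k, Nat.find hex = k + 1 :=
    Nat.exists_eq_succ_of_ne_zero fun h0 => by
      have := Nat.find_spec hex
      rw [h0] at this
      exact absurd this (not_lt.2 hX)
  refine ⟨k, not_lt.1 (Nat.find_min hex (by omega)), ?_⟩
  have := Nat.find_spec hex
  rwa [hk] at this

theorem norm_prod_pow_le {S : Finset Nat.Primes} (a : S → ℕ) (p : S) (n : ℕ) :
    ‖(((∏ q : S, ((q : Nat.Primes) : ℕ) ^ a q : ℕ) : ℚ_[(p : Nat.Primes)]) ^ n)‖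
      ≤ (((((p : Nat.Primes) : ℕ) : ℝ) ^ a p)⁻¹) ^ n := by
  rw [norm_pow]
  refine pow_le_pow_left₀ (norm_nonneg _) ?_ n
  rw [← Finset.mul_prod_erase _ _ (Finset.mem_univ p)]
  push_cast
  rw [norm_mul, Padic.norm_p_pow, _root_.zpow_neg, zpow_natCast]
  refine mul_le_of_le_one_right (by positivity) ?_
  exact_mod_cast Padic.norm_int_le_one (p := ((p : Nat.Primes) : ℕ))
    ((∏ q ∈ Finset.univ.erase p, ((q : Nat.Primes) : ℕ) ^ a q : ℕ) : ℤ)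

/-! ### Simultaneous approximation by the palindromic points -/

theorem mainTheorem5 (S : Finset Nat.Primes) (lam : ℝ × (S → ℝ))
    (hinf : 0 < lam.1) (hp : ∀ p : S, 0 < lam.2 p)
    (hsum : lam.1 + ∑ p : S, lam.2 p < 1 / Real.goldenRatio) :
    ∃ xi : ℝ × ((p : S) → ℚ_[(p : Nat.Primes)]),
      xi ≠ 0 ∧
      2 < Module.rank ℚ ℚ⟮xi.1⟯ ∧
      IsExponentOfApproximation S 2 lam xi := by
  have hφ := Real.goldenRatio_pos
  obtain ⟨b, a, hb, hdvd, hpow, hN⟩ := exists_parameters S (Real.goldenRatio * lam.1)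
    (fun p => Real.goldenRatio * lam.2 p) (fun p => mul_pos hφ (hp p)) (by
      rw [← Finset.mul_sum, ← mul_add, mul_comm]
      exact (lt_div_iff₀ hφ).1 hsum)
  set N : ℕ := ∏ p : S, ((p : Nat.Primes) : ℕ) ^ a p with hNdef
  have hN0 : 0 < N := Finset.prod_pos fun p _ => pow_pos (p : Nat.Primes).2.pos _
  have hb1 : (1 : ℝ) ≤ b := by exact_mod_cast hb
  set Z : ℝ := 7 * (b : ℝ) ^ 2 with hZ
  have hZ1 : 1 < Z := by nlinarith
  have hZ0 : 0 < Z := by linarith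
  have hb2 : (0 : ℝ) < (b : ℝ) ^ 2 := by positivity
  have hμ : 0 < Real.goldenRatio * lam.1 := mul_pos hφ hinf
  have hratio : (N : ℝ) / (b : ℝ) ^ 2 ≤ Z ^ (-(Real.goldenRatio * lam.1)) := by
    rw [Real.rpow_neg hZ0.le, div_le_iff₀ hb2, inv_mul_eq_div, le_div_iff₀ (by positivity)]
    exact hN
  have hZμ : Z ^ (-(Real.goldenRatio * lam.1)) < 1 :=
    Real.rpow_lt_one_of_one_lt_of_neg hZ1 (neg_lt_zero.2 hμ)
  -- Positivity of λ_∞ enters here; the growth bound and the non-commutation of the letters both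
  -- need N ≤ b².
  have hNb : (N : ℤ) ≤ (b : ℤ) ^ 2 := by
    have := (div_lt_one hb2).1 (hratio.trans_lt hZμ)
    exact_mod_cast this.le
  have hbZ : (0 : ℤ) < b := by exact_mod_cast hb
  have hNZ : (0 : ℤ) < N := by exact_mod_cast hN0
  set A := letter (N : ℤ) b with hA
  set B := letter (N : ℤ) (2 * b) with hB
  have hgrowth := growthBound_palSeq_letter hbZ hNZ.le hNb
  have hdet : ∀ k, (palSeq A B k).det = (N : ℤ) ^ palLen k :=
    det_palSeq (det_letter _ _) (det_letter _ _)
  have hsymm : ∀ k, palSeq A B k 1 0 = palSeq A B k 0 1 := fun k =>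
    congrFun (congrFun (transpose_palSeq (transpose_letter _ _) (transpose_letter _ _) k) 0) 1
  have hpre : ∀ k l, k ≤ l → ∃ R : Matrix (Fin 2) (Fin 2) ℤ, (∀ i j, 0 ≤ R i j) ∧
      palSeq A B l = palSeq A B k * R := fun k l hkl =>
    exists_palSeq_eq_mul (letter_nonneg hNZ.le hbZ.le) (letter_nonneg hNZ.le (by linarith)) hkl
  have hpos : ∀ k, 0 < palSeq A B k 1 1 := fun k =>
    (pow_pos (pow_pos hbZ 2) _).trans_le (hgrowth k).2.2
  have hquot : ∀ k, ((palSeq A B k).det : ℝ) / palSeq A B k 1 1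
      ≤ (Z ^ (-(Real.goldenRatio * lam.1))) ^ palLen k := by
    intro k
    refine le_trans ?_ (pow_le_pow_left₀ (by positivity) hratio _)
    rw [div_pow, hdet]
    push_cast
    apply div_le_div_of_nonneg_left (by positivity) (by positivity)
    exact_mod_cast (hgrowth k).2.2
  have hlen : Tendsto palLen atTop atTop :=
    tendsto_atTop_mono (fun k => (lt_palLen k).le) tendsto_id
  have hpowlen : ∀ {r : ℝ}, 0 ≤ r → r < 1 → Tendsto (fun k => r ^ palLen k) atTop (𝓝 0) :=
    fun h0 h1 => (tendsto_pow_atTop_nhds_zero_of_lt_one h0 h1).comp hlen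
  have hquot0 : Tendsto (fun k => ((palSeq A B k).det : ℝ) / palSeq A B k 1 1) atTop (𝓝 0) := by
    refine squeeze_zero (fun k => div_nonneg ?_ ?_) hquot (hpowlen (by positivity) hZμ)
    · rw [hdet]; positivity
    · exact_mod_cast (hpos k).le
  obtain ⟨ξ, C, hC, hξ⟩ := exists_real_limit (T := ((b ^ 2 + N : ℤ) : ℝ)) hsymm hpre
    (by exact_mod_cast (by nlinarith : (1 : ℤ) ≤ b ^ 2 + N))
    (fun k => by
      have := palSeq_letter_row_le hbZ hNZ.le k 0
      rw [hsymm k] at this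
      exact_mod_cast this)
    (fun k => by exact_mod_cast palSeq_letter_row_le hbZ hNZ.le k 1)
    hpos (fun k => by rw [hdet]; positivity) hquot0
  have hpdet : ∀ (p : S) k, ‖(((palSeq A B k).det : ℤ) : ℚ_[(p : Nat.Primes)])‖
      ≤ (Z ^ (-(Real.goldenRatio * lam.2 p))) ^ palLen k := by
    intro p k
    rw [hdet]
    push_cast
    refine (norm_prod_pow_le a p (palLen k)).trans ?_
    refine pow_le_pow_left₀ (by positivity) ?_ _
    rw [Real.rpow_neg hZ0.le]
    exact inv_anti₀ (by positivity) (hpow p)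
  have hη : ∀ p : S, ∃ η : ℚ_[(p : Nat.Primes)], ∀ k, padicL η (point (palSeq A B k))
      ≤ ‖(((palSeq A B k).det : ℤ) : ℚ_[(p : Nat.Primes)])‖ := by
    intro p
    refine exists_padic_limit hsymm (fun k l hkl => ?_) (fun k => ?_) ?_
    · obtain ⟨R, -, hR⟩ := hpre k l hkl
      exact ⟨R, hR⟩
    · exact norm_palSeq_letter_zero_zero (by exact_mod_cast hdvd p) k
    · refine squeeze_zero (fun k => norm_nonneg _) (hpdet p) (hpowlen (by positivity) ?_)
      exact Real.rpow_lt_one_of_one_lt_of_neg hZ1 (neg_lt_zero.2 (mul_pos hφ (hp p)))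
  choose η hη using hη
  have hrank : 2 < Module.rank ℚ ℚ⟮ξ⟯ := by
    refine two_lt_rank_of_tendsto (x := fun k => point (palSeq A B k)) ?_ ?_
    · have ht := hquot0.const_mul C
      rw [mul_zero] at ht
      exact squeeze_zero (fun k => norm_nonneg _) hξ ht
    · intro q hq k
      by_contra! hcon
      exact not_forall_palSeq_eq_zero (transpose_letter _ _) (transpose_letter _ _)
        (by rw [det_letter]; exact hNZ.ne') (by rw [det_letter]; exact hNZ.ne')
        (letter_mul_letter_ne hbZ hNb) hq k hcon
  refine ⟨(ξ, η), ?_, hrank, ?_⟩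
  · intro h0
    have hξ0 : ξ = 0 := congrArg Prod.fst h0
    rw [hξ0, IntermediateField.adjoin_zero, IntermediateField.rank_bot] at hrank
    exact absurd hrank (by norm_num)
  set c : ℝ := (1 + C) * Z ^ (5 * lam.1) + ∑ p : S, Z ^ (5 * lam.2 p) with hc
  have hcinf : (1 + C) * Z ^ (5 * lam.1) ≤ c :=
    le_add_of_nonneg_right (Finset.sum_nonneg fun p _ => by positivity)
  have hcp : ∀ p : S, Z ^ (5 * lam.2 p) ≤ c := fun p =>
    (Finset.single_le_sum (f := fun p : S => Z ^ (5 * lam.2 p)) (fun p _ => by positivity)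
      (Finset.mem_univ p)).trans (le_add_of_nonneg_left (by positivity))
  have hc0 : 0 < c := lt_of_lt_of_le (by positivity) hcinf
  refine ⟨c, hc0, fun X hX => ?_⟩
  have hX0 : 0 < X := by linarith
  have hcX1 : Z ^ (5 * lam.1) * X ^ (-lam.1) + C * (Z ^ (5 * lam.1) * X ^ (-lam.1))
      ≤ c * X ^ (-lam.1) := by
    refine le_trans (le_of_eq (by ring)) (mul_le_mul_of_nonneg_right hcinf (by positivity))
  have hcXp : ∀ p : S, Z ^ (5 * lam.2 p) * X ^ (-lam.2 p) ≤ c * X ^ (-lam.2 p) := fun p =>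
    mul_le_mul_of_nonneg_right (hcp p) (by positivity)
  -- Below the first threshold Z³ the point (0, 0, 1), with all errors at most 1, suffices, as X ≤
  -- Z⁵.
  rcases lt_or_ge X (Z ^ Nat.fib 4) with hXs | hXl
  · have hsmall : ∀ l : ℝ, 0 < l → 1 ≤ Z ^ (5 * l) * X ^ (-l) := by
      intro l hl
      have hXZ : X ≤ Z ^ (5 : ℝ) := by
        refine hXs.le.trans ?_
        rw [← Real.rpow_natCast]
        exact Real.rpow_le_rpow_of_exponent_le hZ1.le (by norm_num [Nat.fib])
      rw [Real.rpow_neg hX0.le, ← div_eq_mul_inv, one_le_div (by positivity), Real.rpow_mul hZ0.le]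
      exact Real.rpow_le_rpow hX0.le hXZ hl.le
    have hne : point !![0, 0; 0, 1] ≠ 0 := fun h => by
      have := congrFun h 2
      simp [point] at this
    refine ⟨point !![0, 0; 0, 1], hne, ?_, ?_, fun p => ?_⟩
    · refine (norm_intCast_fin_three_le (Z := 1) ?_ ?_).trans (by simpa using hX)
      · intro i j; fin_cases i <;> fin_cases j <;> simp
      · intro i; fin_cases i <;> simp
    · refine le_trans (realL_point_le (c := 1) (by simp) (by simp)) ?_
      have := hsmall _ hinf
      have : 0 ≤ C * (Z ^ (5 * lam.1) * X ^ (-lam.1)) := by positivity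
      linarith
    · exact le_trans (padicL_point_le (c := 1) (by simp) (by simp))
        ((hsmall _ (hp p)).trans (hcXp p))
  · obtain ⟨k, hk, hk'⟩ := exists_pow_fib_le_lt hZ1 hXl
    have hne : point (palSeq A B k) ≠ 0 := fun h => (hpos k).ne' (congrFun h 2)
    refine ⟨point (palSeq A B k), hne, ?_, ?_, fun p => ?_⟩
    · refine (norm_intCast_fin_three_le (hgrowth k).1 (hgrowth k).2.1).trans (le_trans ?_ hk)
      rw [← palLen_add_two]
      push_cast
      exact pow_le_pow_right₀ hZ1.le (by omega)
    · have h1 := mul_le_mul_of_nonneg_left ((hquot k).trans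
        (rpow_goldenRatio_pow_palLen_le hZ1.le hX0 hinf.le hk'.le)) hC.le
      have h2 : 0 ≤ Z ^ (5 * lam.1) * X ^ (-lam.1) := by positivity
      have h3 := hξ k
      simp only
      linarith
    · exact ((hη p k).trans (hpdet p k)).trans
        ((rpow_goldenRatio_pow_palLen_le hZ1.le hX0 (hp p).le hk'.le).trans (hcXp p))
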